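/- Let $\mathcal X,\mathcal Y$ be finite non-empty alphabets, let $\mathcal P(\cdot)$ denote the set of probability distributions on a finite set, and let $W:\mathcal X\to\mathcal Y$ be a classical channel, i.e. a stochastic matrix $W(y|x)$, with $W^{\otimes n}(y^n|x^n)=\prod_{i=1}^n W(y_i|x_i)$ and $W_{\min}=\min\{W(y|x): W(y|x)>0\}$. All logarithms are natural. For distributions $p,q$ on a finite set let $P(p,q)=\sqrt{1-\big(\sum_y\sqrt{p(y)q(y)}\big)^2}$ be the purified distance, and for channels $V,\widetilde V:\mathcal A\to\mathcal B$ let $P(V,\widetilde V)=\max_{a} P(V(\cdot|a),\widetilde V(\cdot|a))$. For a real number $M\ge 1$, the optimal non-signaling assisted simulation error of a channel $V:\mathcal A\to\mathcal B$ with communication size $M$ is $$\epsilon^{\mathrm{NS}}(V,M)=\inf\Big\{P(V,\widetilde V)\;:\;\widetilde V:\mathcal A\to\mathcal B\text{ a channel},\ q\in\mathcal P(\mathcal B),\ \widetilde V(b|a)\le M\,q(b)\ \ \forall a\in\mathcal A,\,b\in\mathcal B\Big\}.$$ For $\alpha\in(0,1)$ let $D_\alpha(p\|q)=\frac{1}{\alpha-1}\log\sum_y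 p(y)^\alpha q(y)^{1-\alpha}$ (equal to $+\infty$ if $p$ and $q$ have disjoint supports), and let $D_1(p\|q)=D(p\|q)$ be the relative entropy ($+\infty$ unless $\operatorname{supp}p\subseteq\operatorname{supp}q$); we use $0\cdot\infty=0$ and $e^{-\infty}=0$. For $r\ge 0$ and $n\in\mathbb N$ put $$E_n(W,r)=\inf_{\frac12\le\alpha\le1}\ \inf_{p_X\in\mathcal P(\mathcal X)}\ \sup_{q_Y\in\mathcal P(\mathcal Y)}\exp\Big(-n\,\tfrac{1-\alpha}{\alpha}\big(\mathbb E_{x\sim p_X}D_\alpha(W(\cdot|x)\|q_Y)-r\big)\Big).$$ (1) For all $r\ge 0$, $\eta>0$ and $n\in\mathbb N$, $$1-\epsilon^{\mathrm{NS}}(W^{\otimes n},e^{nr})\ \ge\ \frac{\gamma_n^2}{8}\,e^{-4\sqrt{A(\eta,W)\,n}}\,(1+\eta|\mathcal Y|)^{-n}\,E_n(W,r),$$ where $\gamma_n=(n+1)^{-|\mathcal X|}$ and $A(\eta,W)=2\log^2|\mathcal Y|+\max\big\{\log^2 W_{\min},\ \log^2\tfrac{\eta}{1+\eta|\mathcal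 Y|}\big\}+4$. (2) Consequently (take $\eta=1/n$) there is a constant $C>0$ depending only on $W$ such that, for all $r\ge0$ and all $n\ge 2$, $$1-\epsilon^{\mathrm{NS}}(W^{\otimes n},e^{nr})\ \ge\ e^{-C\sqrt n\,\log n}\,E_n(W,r).$$ -/

import Mathlib

open scoped ENNReal

noncomputable section

namespace ChannelSim

/-- `W x y` is the transition probability `W(y|x)`; a classical channel is a stochastic matrix. -/
def IsChannel {X Y : Type*} [Fintype Y] (W : X → Y → ℝ) : Prop :=
  ∀ x, W x ∈ stdSimplex ℝ Y

/-- The `n`-fold product channel `W^{⊗n}(yⁿ|xⁿ) = ∏ᵢ W(yᵢ|xᵢ)`. -/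
def tensorPower {X Y : Type*} (W : X → Y → ℝ) (n : ℕ) : (Fin n → X) → (Fin n → Y) → ℝ :=
  fun x y => ∏ i, W (x i) (y i)

/-- The fidelity `(∑ √p √q)²` of two distributions. -/
def fidelity {Y : Type*} [Fintype Y] (p q : Y → ℝ) : ℝ :=
  (∑ y, √(p y) * √(q y)) ^ 2

/-- The purified distance `√(1 - F)` of two distributions. -/
def purifiedDist {Y : Type*} [Fintype Y] (p q : Y → ℝ) : ℝ :=
  √(1 - fidelity p q)

/-- The channel purified distance; for a finite nonempty `X` the supremum is a maximum. -/
def channelPurifiedDist {X Y : Type*} [Fintype Y] (W V : X → Y → ℝ) : ℝ :=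
  ⨆ x, purifiedDist (W x) (V x)

/-- The optimal non-signaling simulation error `ε^NS(W, M)` of real communication size `M`: the
infimum of the channel purified distance over channels `V` and distributions `q` on `Y` with
`V(y|x) ≤ M q(y)`. Some pair `(V, q)` is admissible whenever `M ≥ 1` and `Y` is nonempty. -/
def nsError {X Y : Type*} [Fintype Y] (W : X → Y → ℝ) (M : ℝ) : ℝ :=
  sInf {e : ℝ | ∃ (V : X → Y → ℝ) (q : Y → ℝ), IsChannel V ∧ q ∈ stdSimplex ℝ Y ∧
    (∀ x y, V x y ≤ M * q y) ∧ e = channelPurifiedDist W V}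

open Classical in
/-- The Kullback–Leibler divergence of finite distributions, in nats, with values in `EReal`. -/
def klDiv {Y : Type*} [Fintype Y] (p q : Y → ℝ) : EReal :=
  if ∀ y, q y = 0 → p y = 0 then ((∑ y, p y * Real.log (p y / q y) : ℝ) : EReal) else ⊤

open Classical in
/-- The Rényi divergence of order `α > 0`, with `D₁ = D`. The logarithm is `EReal`-valued with
`log 0 = -∞`, so that `D_α = +∞` when `α < 1` and the supports are disjoint. -/
def renyiDiv {Y : Type*} [Fintype Y] (α : ℝ) (p q : Y → ℝ) : EReal :=
  if α = 1 then klDiv p q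
  else if α < 1 ∨ ∀ y, q y = 0 → p y = 0 then
    ((1 / (α - 1) : ℝ) : EReal) *
      ENNReal.log (ENNReal.ofReal (∑ y, p y ^ α * q y ^ (1 - α)))
  else ⊤

/-- The smallest nonzero transition probability of `W`. -/
def minProb {X Y : Type*} (W : X → Y → ℝ) : ℝ :=
  sInf {w : ℝ | ∃ x y, W x y = w ∧ 0 < w}

/-- `A(η, W) = 2 log²|Y| + max {log² W_min, log² (η / (1 + η|Y|))} + 4`. -/
def constA {X Y : Type*} [Fintype Y] (η : ℝ) (W : X → Y → ℝ) : ℝ :=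
  2 * Real.log (Fintype.card Y) ^ 2 +
    max (Real.log (minProb W) ^ 2) (Real.log (η / (1 + η * Fintype.card Y)) ^ 2) + 4

/-- `γ_n = (n+1)^{-|X|}`. -/
def gammaN (X : Type*) [Fintype X] (n : ℕ) : ℝ :=
  (((n : ℝ) + 1) ^ Fintype.card X)⁻¹

/-- `inf_{1/2 ≤ α ≤ 1} inf_{p ∈ P(X)} sup_{q ∈ P(Y)}
exp (- n (1-α)/α (E_{x∼p} D_α(W(·|x) ‖ q) - r))`. The exponent is computed in `EReal`
(where `0 * ⊤ = 0` and `exp (-∞) = 0`) and the value lies in `[0, ∞]`. -/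
def optExp {X Y : Type*} [Fintype X] [Fintype Y] (W : X → Y → ℝ) (n : ℕ) (r : ℝ) : ℝ≥0∞ :=
  ⨅ α ∈ Set.Icc (1 / 2 : ℝ) 1, ⨅ p ∈ stdSimplex ℝ X, ⨆ q ∈ stdSimplex ℝ Y,
    EReal.exp (-(((n * ((1 - α) / α) : ℝ) : EReal) *
      ((∑ x, (p x : EReal) * renyiDiv α (W x) q) - (r : EReal))))

end ChannelSim

end

open scoped ENNReal

noncomputable section

namespace ChannelSim

/-! Put s = (1-α)/α, so that α in [1/2,1] becomes s in [0,1]. The scaled divergence s·D_α(w‖q) has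
the variational form min_t [D(t‖w) + s·D(t‖q)], attained at the tilted distribution proportional to
w^α q^(1-α) (`expo_eq`, `expo_le`). Hence it is concave in s; it is also convex in q.

Fix an input distribution p. A minimax saddle point (`exists_saddle`) gives one output distribution
q_p whose exponent E_p[expo] - s·r is, for every s at once, at most the saddle value, which is what
`optExp` is compared with (`exists_optExp_le`). Restricting q to entries at least η/(1+η|Y|) keeps
the logarithms bounded; this costs the factor (1+η|Y|)^n, since every q is dominated by (1+η|Y|)
times such a distribution.

For a word x of type p, simulate with the product of tilted distributions. By Chebyshev, with
probability at least 1/2 both log-likelihood ratios, against W(·|x) and against q_p^n, exceed their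
means by at most O(√n). Truncating to this event and rescaling gives a subdistribution below e^(nr)
q_p^n with fidelity governed by D(t‖W) + max(0, D(t‖q) - nr) (`exists_subdistribution_pi`). A
suitable s turns this into Σ expo - s·nr (`exists_tilt_parameter`). Averaging the q_p^n over types
yields a single reference distribution that serves all words at the cost of γ_n. Completing to a
true channel and using √(1-c) ≤ 1 - c/2 finishes the bound. -/

section

/-! ### Tilted distributions and the variational exponent. -/

variable {X Y : Type*} [Fintype Y]

/-- The normalization `∑ w^α q^(1-α)` of the geometric mixture of `w` and `q`. -/
def tiltSum (α : ℝ) (w q : Y → ℝ) : ℝ := ∑ y, w y ^ α * q y ^ (1 - α)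

/-- The distribution proportional to `w^α q^(1-α)`. -/
def tilted (α : ℝ) (w q : Y → ℝ) (y : Y) : ℝ := w y ^ α * q y ^ (1 - α) / tiltSum α w q

/-- The relative entropy as a real number. -/
def relEnt (p q : Y → ℝ) : ℝ := ∑ y, p y * (Real.log (p y) - Real.log (q y))

/-- `((1-α)/α) D_α(w‖q)` in the parameter `s = (1-α)/α`. -/
def expo (s : ℝ) (w q : Y → ℝ) : ℝ := -((1 + s) * Real.log (tiltSum (1 + s)⁻¹ w q))

lemma exists_pos_of_mem_stdSimplex {w : Y → ℝ} (hw : w ∈ stdSimplex ℝ Y) : ∃ y, 0 < w y := by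
  by_contra! h
  have := Finset.sum_nonpos (s := Finset.univ) fun y _ => h y
  rw [hw.2] at this
  linarith

lemma le_one_of_mem_stdSimplex {w : Y → ℝ} (hw : w ∈ stdSimplex ℝ Y) (y : Y) : w y ≤ 1 :=
  hw.2 ▸ Finset.single_le_sum (fun z _ => hw.1 z) (Finset.mem_univ y)

lemma tiltSum_pos {α : ℝ} {w q : Y → ℝ} (hw : w ∈ stdSimplex ℝ Y) (hq : ∀ y, 0 < q y) :
    0 < tiltSum α w q := by
  obtain ⟨y, hy⟩ := exists_pos_of_mem_stdSimplex hw
  refine Finset.sum_pos' (fun z _ => ?_) ⟨y, Finset.mem_univ y, ?_⟩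
  · exact mul_nonneg (Real.rpow_nonneg (hw.1 z) _) (Real.rpow_nonneg (hq z).le _)
  · exact mul_pos (Real.rpow_pos_of_pos hy _) (Real.rpow_pos_of_pos (hq y) _)

lemma tilted_pos {α : ℝ} {w q : Y → ℝ} (hw : w ∈ stdSimplex ℝ Y) (hq : ∀ y, 0 < q y) {y : Y}
    (hy : 0 < w y) : 0 < tilted α w q y :=
  div_pos (mul_pos (Real.rpow_pos_of_pos hy _) (Real.rpow_pos_of_pos (hq y) _))
    (tiltSum_pos hw hq)

lemma tilted_eq_zero {α : ℝ} (hα : 0 < α) {w q : Y → ℝ} {y : Y} (hy : w y = 0) :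
    tilted α w q y = 0 := by
  simp [tilted, hy, Real.zero_rpow hα.ne']

lemma tilted_mem_stdSimplex {α : ℝ} {w q : Y → ℝ} (hw : w ∈ stdSimplex ℝ Y)
    (hq : ∀ y, 0 < q y) : tilted α w q ∈ stdSimplex ℝ Y := by
  refine ⟨fun y => ?_, ?_⟩
  · exact div_nonneg (mul_nonneg (Real.rpow_nonneg (hw.1 y) _) (Real.rpow_nonneg (hq y).le _))
      (tiltSum_pos hw hq).le
  · simp only [tilted]
    rw [← Finset.sum_div]
    exact div_self (tiltSum_pos hw hq).ne'

lemma log_tilted {α : ℝ} {w q : Y → ℝ} (hw : w ∈ stdSimplex ℝ Y) (hq : ∀ y, 0 < q y) {y : Y}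
    (hy : 0 < w y) : Real.log (tilted α w q y) =
      α * Real.log (w y) + (1 - α) * Real.log (q y) - Real.log (tiltSum α w q) := by
  rw [tilted, Real.log_div (mul_pos (Real.rpow_pos_of_pos hy _)
    (Real.rpow_pos_of_pos (hq y) _)).ne' (tiltSum_pos hw hq).ne',
    Real.log_mul (Real.rpow_pos_of_pos hy _).ne' (Real.rpow_pos_of_pos (hq y) _).ne',
    Real.log_rpow hy, Real.log_rpow (hq y)]

/-- Decomposition of a mixture of relative entropies around the tilted distribution. -/
lemma mul_relEnt_add_eq {α : ℝ} {w q t : Y → ℝ} (hw : w ∈ stdSimplex ℝ Y)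
    (hq : ∀ y, 0 < q y) (ht : t ∈ stdSimplex ℝ Y) (hsupp : ∀ y, w y = 0 → t y = 0) :
    α * relEnt t w + (1 - α) * relEnt t q =
      relEnt t (tilted α w q) - Real.log (tiltSum α w q) := by
  have h : ∀ y, α * (t y * (Real.log (t y) - Real.log (w y))) +
      (1 - α) * (t y * (Real.log (t y) - Real.log (q y))) =
      t y * (Real.log (t y) - Real.log (tilted α w q y)) - t y * Real.log (tiltSum α w q) := by
    intro y
    rcases (hw.1 y).eq_or_lt with h0 | h0
    · simp [hsupp y h0.symm]
    · rw [log_tilted hw hq h0]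
      ring
  have := Finset.sum_congr (s₁ := Finset.univ) rfl fun y _ => h y
  rw [Finset.sum_add_distrib, Finset.sum_sub_distrib, ← Finset.mul_sum, ← Finset.mul_sum,
    ← Finset.sum_mul, ht.2, one_mul] at this
  exact this

lemma relEnt_self (t : Y → ℝ) : relEnt t t = 0 := by simp [relEnt]

lemma relEnt_nonneg {t u : Y → ℝ} (ht : t ∈ stdSimplex ℝ Y) (hu : u ∈ stdSimplex ℝ Y)
    (hsupp : ∀ y, u y = 0 → t y = 0) : 0 ≤ relEnt t u := by
  have h : ∀ y, t y - u y ≤ t y * (Real.log (t y) - Real.log (u y)) := by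
    intro y
    rcases (ht.1 y).eq_or_lt with h0 | h0
    · simp [← h0, hu.1 y]
    · have hu0 : 0 < u y := (hu.1 y).lt_of_ne fun h => h0.ne' (hsupp y h.symm)
      have := Real.log_le_sub_one_of_pos (div_pos hu0 h0)
      rw [Real.log_div hu0.ne' h0.ne'] at this
      have h2 := mul_le_mul_of_nonneg_left this h0.le
      have h3 : t y * (u y / t y - 1) = u y - t y := by field_simp
      linarith
  have := Finset.sum_le_sum (s := Finset.univ) fun y _ => h y
  rw [Finset.sum_sub_distrib, ht.2, hu.2, sub_self] at this
  exact this

/-- The tilted distribution attains the variational minimum: in the decomposition around it the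
residual relative entropy vanishes. -/
lemma expo_eq {s : ℝ} (hs : 0 ≤ s) {w q : Y → ℝ} (hw : w ∈ stdSimplex ℝ Y)
    (hq : ∀ y, 0 < q y) : expo s w q =
      relEnt (tilted (1 + s)⁻¹ w q) w + s * relEnt (tilted (1 + s)⁻¹ w q) q := by
  have h := mul_relEnt_add_eq (α := (1 + s)⁻¹) hw hq (tilted_mem_stdSimplex (α := (1 + s)⁻¹) hw hq)
    fun y hy => tilted_eq_zero (by positivity) hy
  rw [relEnt_self] at h
  have h1 : (1 + s) ≠ 0 := by positivity
  have h2 : ∀ a b : ℝ, (1 + s) * ((1 + s)⁻¹ * a + (1 - (1 + s)⁻¹) * b) = a + s * b := by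
    intro a b
    field_simp
    ring
  rw [expo, ← h2, h]
  ring

/-- The variational upper bound on `expo`. -/
lemma expo_le {s : ℝ} (hs : 0 ≤ s) {w q t : Y → ℝ} (hw : w ∈ stdSimplex ℝ Y)
    (hq : ∀ y, 0 < q y) (ht : t ∈ stdSimplex ℝ Y) (hsupp : ∀ y, w y = 0 → t y = 0) :
    expo s w q ≤ relEnt t w + s * relEnt t q := by
  have h := mul_relEnt_add_eq (α := (1 + s)⁻¹) hw hq ht hsupp
  have h0 := relEnt_nonneg ht (tilted_mem_stdSimplex (α := (1 + s)⁻¹) hw hq) fun y hy => by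
    rcases (hw.1 y).eq_or_lt with hw0 | hw0
    · exact hsupp y hw0.symm
    · exact absurd hy (tilted_pos hw hq hw0).ne'
  have h1 : 0 < 1 + s := by positivity
  have h2 : -Real.log (tiltSum (1 + s)⁻¹ w q) ≤
      (1 + s)⁻¹ * relEnt t w + (1 - (1 + s)⁻¹) * relEnt t q := by linarith
  have h3 := mul_le_mul_of_nonneg_left h2 h1.le
  have h4 : (1 + s) * ((1 + s)⁻¹ * relEnt t w + (1 - (1 + s)⁻¹) * relEnt t q) =
      relEnt t w + s * relEnt t q := by
    field_simp
    ring
  rw [expo]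
  linarith

/-- An infimum of functions affine in s. The minimizer at the intermediate parameter is used as
competitor at both endpoints. -/
lemma concaveOn_expo {w q : Y → ℝ} (hw : w ∈ stdSimplex ℝ Y) (hq : ∀ y, 0 < q y) :
    ConcaveOn ℝ (Set.Icc 0 1) fun s => expo s w q := by
  refine ⟨convex_Icc 0 1, fun s hs s' hs' a b ha hb hab => ?_⟩
  have hm : 0 ≤ a * s + b * s' := add_nonneg (mul_nonneg ha hs.1) (mul_nonneg hb hs'.1)
  have ht := tilted_mem_stdSimplex (α := (1 + (a * s + b * s'))⁻¹) hw hq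
  have hsupp : ∀ y, w y = 0 → tilted (1 + (a * s + b * s'))⁻¹ w q y = 0 :=
    fun y hy => tilted_eq_zero (by positivity) hy
  simp only [smul_eq_mul]
  rw [expo_eq hm hw hq]
  have h1 := mul_le_mul_of_nonneg_left (expo_le hs.1 hw hq ht hsupp) ha
  have h2 := mul_le_mul_of_nonneg_left (expo_le hs'.1 hw hq ht hsupp) hb
  have h3 : b = 1 - a := by linarith
  subst h3
  nlinarith

lemma concaveOn_tiltSum {α : ℝ} (h0 : 0 ≤ α) (h1 : α ≤ 1) {w : Y → ℝ}
    (hw : ∀ y, 0 ≤ w y) : ConcaveOn ℝ {q : Y → ℝ | ∀ y, 0 < q y} fun q => tiltSum α w q := by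
  have hconv : Convex ℝ {q : Y → ℝ | ∀ y, 0 < q y} := by
    intro q hq q' hq' a b ha hb hab y
    have : 0 < a • q y + b • q' y := (convex_Ioi (0 : ℝ)) (hq y) (hq' y) ha hb hab
    simpa using this
  refine ⟨hconv, fun q hq q' hq' a b ha hb hab => ?_⟩
  simp only [tiltSum, smul_eq_mul, Finset.mul_sum, ← Finset.sum_add_distrib]
  refine Finset.sum_le_sum fun y _ => ?_
  have := (Real.concaveOn_rpow (sub_nonneg.2 h1) (by linarith : 1 - α ≤ 1)).2
    (hq y).le (hq' y).le ha hb hab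
  simp only [smul_eq_mul] at this
  have h2 := mul_le_mul_of_nonneg_left this (Real.rpow_nonneg (hw y) α)
  simp only [Pi.add_apply, Pi.smul_apply, smul_eq_mul]
  linarith

/-- `tiltSum` is concave in q, its logarithm is therefore concave, and the factor -(1+s) reverses
the sign. -/
lemma convexOn_expo {s : ℝ} (hs : 0 ≤ s) {w : Y → ℝ} (hw : w ∈ stdSimplex ℝ Y) :
    ConvexOn ℝ {q : Y → ℝ | ∀ y, 0 < q y} fun q => expo s w q := by
  have hc := concaveOn_tiltSum (α := (1 + s)⁻¹) (by positivity)
    (inv_le_one_of_one_le₀ (by linarith)) hw.1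
  refine ⟨hc.1, fun q hq q' hq' a b ha hb hab => ?_⟩
  have h1 := hc.2 hq hq' ha hb hab
  have hp := tiltSum_pos (α := (1 + s)⁻¹) hw hq
  have hp' := tiltSum_pos (α := (1 + s)⁻¹) hw hq'
  have h2 := strictConcaveOn_log_Ioi.concaveOn.2 hp hp' ha hb hab
  have h3 : (0 : ℝ) < a • tiltSum (1 + s)⁻¹ w q + b • tiltSum (1 + s)⁻¹ w q' :=
    (convex_Ioi (0 : ℝ)) hp hp' ha hb hab
  have h4 := h2.trans (Real.log_le_log h3 h1)
  have h5 := mul_le_mul_of_nonneg_left h4 (by linarith : 0 ≤ 1 + s)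
  simp only [expo, smul_eq_mul] at h5 ⊢
  linarith

lemma continuousOn_tiltSum_inv (w : Y → ℝ) {q : Y → ℝ} (hq : ∀ y, 0 < q y) :
    ContinuousOn (fun s : ℝ => tiltSum (1 + s)⁻¹ w q) (Set.Icc 0 1) := by
  have h1 : ContinuousOn (fun s : ℝ => (1 + s)⁻¹) (Set.Icc 0 1) :=
    (continuousOn_const.add continuousOn_id).inv₀ fun s hs =>
      (add_pos_of_pos_of_nonneg one_pos hs.1).ne'
  refine continuousOn_finsetSum _ fun y _ => ContinuousOn.mul ?_ ?_
  · intro s hs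
    have := hs.1
    exact ContinuousWithinAt.rpow continuousWithinAt_const (h1 s hs) (Or.inr (by positivity))
  · intro s hs
    exact ContinuousWithinAt.rpow continuousWithinAt_const (continuousWithinAt_const.sub (h1 s hs))
      (Or.inl (hq y).ne')

lemma continuousOn_expo_left {w q : Y → ℝ} (hw : w ∈ stdSimplex ℝ Y) (hq : ∀ y, 0 < q y) :
    ContinuousOn (fun s => expo s w q) (Set.Icc 0 1) :=
  ((continuousOn_const.add continuousOn_id).mul
    ((continuousOn_tiltSum_inv w hq).log fun _ _ => (tiltSum_pos hw hq).ne')).neg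

lemma continuousOn_expo_right {s : ℝ} {w : Y → ℝ} (hw : w ∈ stdSimplex ℝ Y) :
    ContinuousOn (fun q => expo s w q) {q : Y → ℝ | ∀ y, 0 < q y} := by
  refine (continuousOn_const.mul (ContinuousOn.log ?_ fun q hq => (tiltSum_pos hw hq).ne')).neg
  refine continuousOn_finsetSum _ fun y _ => continuousOn_const.mul ?_
  intro q hq
  exact ContinuousWithinAt.rpow (continuous_apply y).continuousWithinAt continuousWithinAt_const
    (Or.inl (hq y).ne')

lemma continuousOn_relEnt_tilted {w q : Y → ℝ} (hw : w ∈ stdSimplex ℝ Y) (hq : ∀ y, 0 < q y) :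
    ContinuousOn (fun s => relEnt (tilted (1 + s)⁻¹ w q) q) (Set.Icc 0 1) := by
  have h1 : ContinuousOn (fun s : ℝ => (1 + s)⁻¹) (Set.Icc 0 1) :=
    (continuousOn_const.add continuousOn_id).inv₀ fun s hs =>
      (add_pos_of_pos_of_nonneg one_pos hs.1).ne'
  have ht : ∀ y, ContinuousOn (fun s => tilted (1 + s)⁻¹ w q y) (Set.Icc 0 1) := by
    intro y
    refine ContinuousOn.div (ContinuousOn.mul ?_ ?_) (continuousOn_tiltSum_inv w hq)
      fun _ _ => (tiltSum_pos hw hq).ne'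
    · intro s hs
      have := hs.1
      exact ContinuousWithinAt.rpow continuousWithinAt_const (h1 s hs) (Or.inr (by positivity))
    · intro s hs
      exact ContinuousWithinAt.rpow continuousWithinAt_const
        (continuousWithinAt_const.sub (h1 s hs)) (Or.inl (hq y).ne')
  refine continuousOn_finsetSum _ fun y _ => ?_
  simp only [mul_sub]
  exact (Real.continuous_mul_log.comp_continuousOn (ht y)).sub ((ht y).mul continuousOn_const)

lemma expo_zero {w q : Y → ℝ} (hw : w ∈ stdSimplex ℝ Y) : expo 0 w q = 0 := by
  simp [expo, tiltSum, hw.2]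

/-! ### Second moments of log-likelihoods, bounded uniformly in the tilting parameter. -/

lemma mul_log_sq_le_one {z : ℝ} (h0 : 0 < z) (h1 : z ≤ 1) : z * Real.log z ^ 2 ≤ 1 := by
  -- With z = u^4 the quantity is (4 u² log u)², and u² log u ≥ u² - u ≥ -1/4.
  set u := z ^ (1 / 4 : ℝ) with hu
  have hu0 : 0 < u := Real.rpow_pos_of_pos h0 _
  have hz : z = u ^ 4 := by
    rw [hu, ← Real.rpow_natCast, ← Real.rpow_mul h0.le]
    norm_num
  have hu1 : u ≤ 1 := Real.rpow_le_one h0.le h1 (by norm_num)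
  have hl : Real.log z = 4 * Real.log u := by rw [hz, Real.log_pow]; norm_num
  have h2 := Real.one_sub_inv_le_log_of_pos hu0
  have h3 : Real.log u ≤ 0 := Real.log_nonpos hu0.le hu1
  have h4 : u ^ 2 * (1 - u⁻¹) = u ^ 2 - u := by field_simp
  have h5 := mul_le_mul_of_nonneg_left h2 (sq_nonneg u)
  have h6 : u ^ 2 * Real.log u ≤ 0 := mul_nonpos_of_nonneg_of_nonpos (sq_nonneg u) h3
  have h7 : -(1 / 4) ≤ u ^ 2 * Real.log u := by nlinarith [sq_nonneg (u - 1 / 2)]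
  rw [hl, hz]
  nlinarith

/-- The second moment of the information content is at most `2 log²|Y| + 2`. -/
lemma sum_mul_log_sq_le {t : Y → ℝ} (ht : t ∈ stdSimplex ℝ Y) :
    ∑ y, t y * Real.log (t y) ^ 2 ≤ 2 * Real.log (Fintype.card Y) ^ 2 + 2 := by
  obtain ⟨y₀, -⟩ := exists_pos_of_mem_stdSimplex ht
  have hk : (1 : ℝ) ≤ Fintype.card Y := by
    exact_mod_cast Fintype.card_pos_iff.2 ⟨y₀⟩
  obtain ⟨k, hkdef⟩ : ∃ k : ℝ, k = Fintype.card Y := ⟨_, rfl⟩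
  rw [← hkdef] at hk ⊢
  have hk0 : 0 < k := by linarith
  have hpt : ∀ y, t y * Real.log (t y) ^ 2 ≤ t y * (2 * Real.log k ^ 2) + 2 / k := by
    intro y
    rcases (ht.1 y).eq_or_lt with h0 | h0
    · rw [← h0]; simp; positivity
    -- Small probabilities are compared with 1/k and contribute at most 2/k each, hence 2 in total;
    -- for the others |log t| ≤ log k.
    rcases le_total (k * t y) 1 with h1 | h1
    · have h2 := mul_log_sq_le_one (mul_pos hk0 h0) h1
      have h3 : Real.log (t y) = Real.log (k * t y) - Real.log k := by
        rw [Real.log_mul hk0.ne' h0.ne']; ring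
      have h4 : Real.log (t y) ^ 2 ≤ 2 * Real.log (k * t y) ^ 2 + 2 * Real.log k ^ 2 := by
        rw [h3]; nlinarith [sq_nonneg (Real.log (k * t y) + Real.log k)]
      have h5 := mul_le_mul_of_nonneg_left h4 h0.le
      have h6 : t y * Real.log (k * t y) ^ 2 ≤ 1 / k := by
        rw [le_div_iff₀ hk0]; linarith
      have h7 : 2 / k = 2 * (1 / k) := by ring
      rw [h7]; linarith
    · have h2 : Real.log (t y) ≤ 0 := Real.log_nonpos h0.le (le_one_of_mem_stdSimplex ht y)
      have h3 := Real.log_nonneg h1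
      rw [Real.log_mul hk0.ne' h0.ne'] at h3
      have h4 : Real.log (t y) ^ 2 ≤ 2 * Real.log k ^ 2 := by nlinarith
      have := mul_le_mul_of_nonneg_left h4 h0.le
      have : 0 < 2 / k := by positivity
      linarith
  refine (Finset.sum_le_sum fun y _ => hpt y).trans ?_
  rw [Finset.sum_add_distrib, ← Finset.sum_mul, ht.2, Finset.sum_const, Finset.card_univ,
    nsmul_eq_mul, ← hkdef]
  field_simp
  linarith

/-- The second moment of a log-likelihood ratio, when the reference distribution is bounded away
from zero on the support of `t`. -/
lemma sum_mul_log_sub_sq_le {t u : Y → ℝ} {B : ℝ} (ht : t ∈ stdSimplex ℝ Y)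
    (hu : ∀ y, 0 < t y → 0 < u y ∧ u y ≤ 1 ∧ Real.log (u y) ^ 2 ≤ B) :
    ∑ y, t y * (Real.log (t y) - Real.log (u y)) ^ 2 ≤
      2 * Real.log (Fintype.card Y) ^ 2 + B + 4 := by
  have hpt : ∀ y, t y * (Real.log (t y) - Real.log (u y)) ^ 2 ≤
      t y * Real.log (t y) ^ 2 + t y * B := by
    intro y
    rcases (ht.1 y).eq_or_lt with h0 | h0
    · simp [← h0]
    obtain ⟨h1, h2, h3⟩ := hu y h0
    have h4 : Real.log (t y) ≤ 0 := Real.log_nonpos h0.le (le_one_of_mem_stdSimplex ht y)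
    have h5 : Real.log (u y) ≤ 0 := Real.log_nonpos h1.le h2
    rw [← mul_add]
    refine mul_le_mul_of_nonneg_left ?_ h0.le
    -- Both logarithms are nonpositive, so the cross term only helps and (a-b)² ≤ a² + b².
    nlinarith [mul_nonneg_of_nonpos_of_nonpos h4 h5]
  refine (Finset.sum_le_sum fun y _ => hpt y).trans ?_
  rw [Finset.sum_add_distrib, ← Finset.sum_mul, ht.2]
  linarith [sum_mul_log_sq_le ht]

end

/-! ### Chebyshev for product distributions, truncation and the choice of tilt. -/

section

variable {X Y : Type*} [Fintype Y]

section Product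

variable {ι : Type*} [Fintype ι] [DecidableEq ι]

lemma prod_mem_stdSimplex {t : ι → Y → ℝ} (ht : ∀ i, t i ∈ stdSimplex ℝ Y) :
    (fun y : ι → Y => ∏ i, t i (y i)) ∈ stdSimplex ℝ (ι → Y) := by
  refine ⟨fun y => Finset.prod_nonneg fun i _ => (ht i).1 _, ?_⟩
  have := Finset.prod_univ_sum (fun _ : ι => (Finset.univ : Finset Y)) fun i y => t i y
  rw [Fintype.piFinset_univ] at this
  rw [← this]
  exact Finset.prod_eq_one fun i _ => (ht i).2

/-- Independent centred variables are uncorrelated. -/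
lemma sum_prod_mul_mul {t g : ι → Y → ℝ} (ht : ∀ i, t i ∈ stdSimplex ℝ Y)
    (hg : ∀ i, ∑ y, t i y * g i y = 0) (i k : ι) :
    ∑ y : ι → Y, (∏ j, t j (y j)) * (g i (y i) * g k (y k)) =
      if i = k then ∑ y, t i y * g i y ^ 2 else 0 := by
  have h1 : ∀ y : ι → Y, (∏ j, t j (y j)) * (g i (y i) * g k (y k)) =
      ∏ j, t j (y j) * ((if j = i then g i (y j) else 1) * (if j = k then g k (y j) else 1)) := by
    intro y
    rw [Finset.prod_mul_distrib, Finset.prod_mul_distrib]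
    simp
  have h2 := Finset.prod_univ_sum (fun _ : ι => (Finset.univ : Finset Y))
    fun j y => t j y * ((if j = i then g i y else 1) * (if j = k then g k y else 1))
  rw [Fintype.piFinset_univ] at h2
  rw [Finset.sum_congr rfl fun y _ => h1 y, ← h2]
  split_ifs with h
  · subst h
    rw [Finset.prod_eq_single i]
    · exact Finset.sum_congr rfl fun y _ => by simp [sq]
    · intro j _ hj
      simp [hj, (ht j).2]
    · simp
  · refine Finset.prod_eq_zero (Finset.mem_univ i) ?_
    simpa [h] using hg i

lemma sum_prod_mul_sum_sq {t g : ι → Y → ℝ} (ht : ∀ i, t i ∈ stdSimplex ℝ Y)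
    (hg : ∀ i, ∑ y, t i y * g i y = 0) :
    ∑ y : ι → Y, (∏ j, t j (y j)) * (∑ i, g i (y i)) ^ 2 = ∑ i, ∑ y, t i y * g i y ^ 2 := by
  have h1 : ∀ y : ι → Y, (∏ j, t j (y j)) * (∑ i, g i (y i)) ^ 2 =
      ∑ i, ∑ k, (∏ j, t j (y j)) * (g i (y i) * g k (y k)) := by
    intro y
    rw [sq, Finset.sum_mul_sum, Finset.mul_sum]
    exact Finset.sum_congr rfl fun i _ => Finset.mul_sum _ _ _
  rw [Finset.sum_congr rfl fun y _ => h1 y, Finset.sum_comm]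
  refine Finset.sum_congr rfl fun i _ => ?_
  rw [Finset.sum_comm, Finset.sum_congr rfl fun k _ => sum_prod_mul_mul ht hg i k]
  simp

/-- Chebyshev's inequality for a sum of independent variables with mean `m i` and second moment at
most `v`. -/
lemma sum_prod_filter_le {t l : ι → Y → ℝ} {m : ι → ℝ} {v a : ℝ}
    (ht : ∀ i, t i ∈ stdSimplex ℝ Y) (hm : ∀ i, ∑ y, t i y * l i y = m i)
    (hv : ∀ i, ∑ y, t i y * l i y ^ 2 ≤ v) (ha : 0 < a) :
    ∑ y : ι → Y with (∑ i, m i) + a < ∑ i, l i (y i), ∏ i, t i (y i) ≤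
      Fintype.card ι * v / a ^ 2 := by
  have hg : ∀ i, ∑ y, t i y * (l i y - m i) = 0 := by
    intro i
    simp only [mul_sub]
    rw [Finset.sum_sub_distrib, hm, ← Finset.sum_mul, (ht i).2, one_mul, sub_self]
  have hg2 : ∀ i, ∑ y, t i y * (l i y - m i) ^ 2 ≤ v := by
    intro i
    have h1 : ∀ y, t i y * (l i y - m i) ^ 2 =
        t i y * l i y ^ 2 - t i y * l i y * (2 * m i) + t i y * m i ^ 2 := by
      intro y; ring
    rw [Finset.sum_congr rfl fun y _ => h1 y, Finset.sum_add_distrib, Finset.sum_sub_distrib,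
      ← Finset.sum_mul, ← Finset.sum_mul, hm, (ht i).2]
    nlinarith [hv i, sq_nonneg (m i)]
  rw [le_div_iff₀ (by positivity), Finset.sum_mul]
  have h0 : ∀ y : ι → Y, 0 ≤ ∏ i, t i (y i) := (prod_mem_stdSimplex ht).1
  calc ∑ y : ι → Y with (∑ i, m i) + a < ∑ i, l i (y i), (∏ i, t i (y i)) * a ^ 2
      ≤ ∑ y : ι → Y with (∑ i, m i) + a < ∑ i, l i (y i),
          (∏ i, t i (y i)) * (∑ i, (l i (y i) - m i)) ^ 2 := by
        refine Finset.sum_le_sum fun y hy => mul_le_mul_of_nonneg_left ?_ (h0 y)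
        have := (Finset.mem_filter.1 hy).2
        rw [Finset.sum_sub_distrib]
        exact pow_le_pow_left₀ ha.le (by linarith) 2
    _ ≤ ∑ y : ι → Y, (∏ i, t i (y i)) * (∑ i, (l i (y i) - m i)) ^ 2 :=
        Finset.sum_le_sum_of_subset_of_nonneg (Finset.filter_subset _ _)
          fun y _ _ => mul_nonneg (h0 y) (sq_nonneg _)
    _ ≤ Fintype.card ι * v := by
        rw [sum_prod_mul_sum_sq (g := fun i y => l i y - m i) ht hg]
        refine (Finset.sum_le_sum fun i _ => hg2 i).trans ?_
        simp

end Product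

/-- Truncating and rescaling `t` yields a subdistribution below `e^R Q` of large fidelity
with `P`. -/
lemma exists_subdistribution {Ω : Type*} [Fintype Ω] {P Q t : Ω → ℝ} {d e a R : ℝ}
    (hQ : ∀ ω, 0 ≤ Q ω) (ht : t ∈ stdSimplex ℝ Ω) (ha : 0 ≤ a)
    (S : Finset Ω) (hS : 1 / 2 ≤ ∑ ω ∈ S, t ω)
    (hSQ : ∀ ω ∈ S, t ω ≤ Real.exp (d + a) * Q ω)
    (hSP : ∀ ω ∈ S, t ω ≤ Real.exp (e + a) * P ω) :
    ∃ U : Ω → ℝ, (∀ ω, 0 ≤ U ω) ∧ ∑ ω, U ω ≤ 1 ∧ (∀ ω, U ω ≤ Real.exp R * Q ω) ∧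
      1 / 4 * Real.exp (-(2 * a)) * Real.exp (-(e + max 0 (d - R))) ≤ fidelity P U := by
  classical
  -- The factor e^(-a) absorbs the fluctuation; the rest pays for the excess of d over the rate R.
  set c := Real.exp (-a - max 0 (d - R)) with hc
  have hc1 : c ≤ 1 := Real.exp_le_one_iff.2 (by linarith [le_max_left 0 (d - R)])
  have hc0 : 0 < c := Real.exp_pos _
  refine ⟨fun ω => if ω ∈ S then c * t ω else 0, fun ω => ?_, ?_, fun ω => ?_, ?_⟩
  · dsimp only
    split_ifs
    · exact mul_nonneg hc0.le (ht.1 ω)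
    · exact le_rfl
  · rw [← ht.2]
    refine Finset.sum_le_sum fun ω _ => ?_
    split_ifs
    · exact mul_le_of_le_one_left (ht.1 ω) hc1
    · exact ht.1 ω
  · dsimp only
    split_ifs with h
    · calc c * t ω ≤ c * (Real.exp (d + a) * Q ω) := mul_le_mul_of_nonneg_left (hSQ ω h) hc0.le
        _ = Real.exp (-a - max 0 (d - R) + (d + a)) * Q ω := by rw [Real.exp_add _ (d + a), hc]; ring
        _ ≤ Real.exp R * Q ω := by
          refine mul_le_mul_of_nonneg_right (Real.exp_le_exp.2 ?_) (hQ ω)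
          linarith [le_max_right 0 (d - R)]
    · exact mul_nonneg (Real.exp_pos R).le (hQ ω)
  · set k := Real.exp (-(e + a)) * c with hk
    have hk0 : 0 ≤ k := by positivity
    have h1 : √k * (1 / 2) ≤
        ∑ ω, √(P ω) * √(if ω ∈ S then c * t ω else 0) := by
      calc √k * (1 / 2) ≤ √k * ∑ ω ∈ S, t ω := mul_le_mul_of_nonneg_left hS (Real.sqrt_nonneg _)
        _ = ∑ ω ∈ S, √k * t ω := Finset.mul_sum _ _ _
        _ ≤ ∑ ω ∈ S, √(P ω) * √(if ω ∈ S then c * t ω else 0) := by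
          refine Finset.sum_le_sum fun ω h => ?_
          rw [if_pos h]
          have h2 : Real.exp (-(e + a)) * t ω ≤ P ω := by
            rw [Real.exp_neg, inv_mul_le_iff₀ (Real.exp_pos _)]
            exact hSP ω h
          have hP : 0 ≤ P ω := le_trans (mul_nonneg (Real.exp_pos _).le (ht.1 ω)) h2
          rw [← Real.sqrt_mul hP]
          refine Real.le_sqrt_of_sq_le ?_
          rw [mul_pow, Real.sq_sqrt hk0, hk]
          calc Real.exp (-(e + a)) * c * t ω ^ 2
              = (Real.exp (-(e + a)) * t ω) * (c * t ω) := by ring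
            _ ≤ P ω * (c * t ω) :=
              mul_le_mul_of_nonneg_right h2 (mul_nonneg hc0.le (ht.1 ω))
        _ ≤ _ := Finset.sum_le_sum_of_subset_of_nonneg (Finset.subset_univ _)
            fun ω _ _ => mul_nonneg (Real.sqrt_nonneg _) (Real.sqrt_nonneg _)
    have h2 := pow_le_pow_left₀ (by positivity) h1 2
    rw [fidelity]
    refine le_trans (le_of_eq ?_) h2
    rw [mul_pow, Real.sq_sqrt hk0, hk, hc, ← Real.exp_add, mul_assoc, ← Real.exp_add]
    have h3 : -(2 * a) + -(e + max 0 (d - R)) = -(e + a) + (-a - max 0 (d - R)) := by ring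
    rw [h3]
    ring

/-- A product of channel outputs admits a subdistribution below `e^R q^n` whose fidelity with it
is governed by the divergences of the tilted distributions. -/
lemma exists_subdistribution_pi {n : ℕ} (hn : n ≠ 0) {w : Fin n → Y → ℝ} {q : Y → ℝ}
    {α B R : ℝ} (hα : 0 < α) (hw : ∀ i, w i ∈ stdSimplex ℝ Y)
    (hq : q ∈ stdSimplex ℝ Y) (hq0 : ∀ y, 0 < q y)
    (hwB : ∀ i y, 0 < w i y → Real.log (w i y) ^ 2 ≤ B) (hqB : ∀ y, Real.log (q y) ^ 2 ≤ B) :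
    ∃ U : (Fin n → Y) → ℝ, (∀ y, 0 ≤ U y) ∧ ∑ y, U y ≤ 1 ∧
      (∀ y, U y ≤ Real.exp R * ∏ i, q (y i)) ∧
      1 / 4 * Real.exp (-4 * √((2 * Real.log (Fintype.card Y) ^ 2 + B + 4) * n)) *
        Real.exp (-(∑ i, relEnt (tilted α (w i) q) (w i) +
          max 0 (∑ i, relEnt (tilted α (w i) q) q - R))) ≤
        fidelity (fun y => ∏ i, w i (y i)) U := by
  classical
  set A := 2 * Real.log (Fintype.card Y) ^ 2 + B + 4 with hA
  set t : Fin n → Y → ℝ := fun i => tilted α (w i) q with ht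
  have htm : ∀ i, t i ∈ stdSimplex ℝ Y := fun i => tilted_mem_stdSimplex (hw i) hq0
  have htw : ∀ i y, 0 < t i y → 0 < w i y := by
    intro i y h
    refine ((hw i).1 y).lt_of_ne fun h0 => ?_
    exact h.ne' (tilted_eq_zero hα h0.symm)
  have hB : 0 ≤ B := by
    obtain ⟨y, -⟩ := exists_pos_of_mem_stdSimplex hq
    exact (sq_nonneg _).trans (hqB y)
  have hA0 : 0 < A := by positivity
  have hn0 : (0 : ℝ) < n := by positivity
  -- This deviation makes each Chebyshev failure probability at most 1/4, so the two together leave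
  -- mass 1/2.
  set a := 2 * √(A * n) with ha
  have ha0 : 0 < a := by positivity
  have ha2 : a ^ 2 = 4 * (A * n) := by rw [ha, mul_pow, Real.sq_sqrt (by positivity)]; norm_num
  have hquart : (Fintype.card (Fin n) : ℝ) * A / a ^ 2 = 1 / 4 := by
    rw [ha2, Fintype.card_fin]
    field_simp
  have h1 := sum_prod_filter_le (t := t) (l := fun i y => Real.log (t i y) - Real.log (q y))
    (m := fun i => relEnt (t i) q) (v := A) (a := a) htm (fun i => rfl)
    (fun i => sum_mul_log_sub_sq_le (htm i) fun y _ =>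
      ⟨hq0 y, le_one_of_mem_stdSimplex hq y, hqB y⟩) ha0
  have h2 := sum_prod_filter_le (t := t) (l := fun i y => Real.log (t i y) - Real.log (w i y))
    (m := fun i => relEnt (t i) (w i)) (v := A) (a := a) htm (fun i => rfl)
    (fun i => sum_mul_log_sub_sq_le (htm i) fun y hy =>
      ⟨htw i y hy, le_one_of_mem_stdSimplex (hw i) y, hwB i y (htw i y hy)⟩) ha0
  rw [hquart] at h1 h2
  set S₁ : Finset (Fin n → Y) := Finset.univ.filter fun y =>
    (∑ i, relEnt (t i) q) + a < ∑ i, (Real.log (t i (y i)) - Real.log (q (y i))) with hS₁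
  set S₂ : Finset (Fin n → Y) := Finset.univ.filter fun y =>
    (∑ i, relEnt (t i) (w i)) + a < ∑ i, (Real.log (t i (y i)) - Real.log (w i (y i))) with hS₂
  have hT := prod_mem_stdSimplex htm
  have hmass : 1 / 2 ≤ ∑ y ∈ (S₁ ∪ S₂)ᶜ, ∏ i, t i (y i) := by
    have h3 := Finset.sum_add_sum_compl (S₁ ∪ S₂) fun y => ∏ i, t i (y i)
    have h4 := Finset.sum_union_inter (s₁ := S₁) (s₂ := S₂) (f := fun y => ∏ i, t i (y i))
    have h5 : 0 ≤ ∑ y ∈ S₁ ∩ S₂, ∏ i, t i (y i) := Finset.sum_nonneg fun y _ => hT.1 y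
    rw [hT.2] at h3
    linarith
  have hle : ∀ (u : Fin n → Y → ℝ) (b : ℝ) (y : Fin n → Y),
      (∀ i, 0 ≤ u i (y i)) → (∀ i, 0 < t i (y i) → 0 < u i (y i)) →
      ∑ i, (Real.log (t i (y i)) - Real.log (u i (y i))) ≤ b →
      ∏ i, t i (y i) ≤ Real.exp b * ∏ i, u i (y i) := by
    intro u b y hu hu' hb
    -- At a zero of t the logarithm takes its default value 0 and carries no information, but the
    -- product bound is then trivial.
    by_cases h0 : ∃ i, t i (y i) = 0
    · obtain ⟨i, hi⟩ := h0
      rw [Finset.prod_eq_zero (Finset.mem_univ i) hi]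
      exact mul_nonneg (Real.exp_pos _).le (Finset.prod_nonneg fun i _ => hu i)
    · push Not at h0
      have htp : ∀ i, 0 < t i (y i) := fun i => ((htm i).1 _).lt_of_ne (h0 i).symm
      have hup : ∀ i, 0 < u i (y i) := fun i => hu' i (htp i)
      rw [Finset.sum_sub_distrib, ← Real.log_prod fun i _ => (htp i).ne',
        ← Real.log_prod fun i _ => (hup i).ne', ← Real.log_div
          (Finset.prod_pos fun i _ => htp i).ne' (Finset.prod_pos fun i _ => hup i).ne',
        Real.log_le_iff_le_exp (div_pos (Finset.prod_pos fun i _ => htp i)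
          (Finset.prod_pos fun i _ => hup i)), div_le_iff₀ (Finset.prod_pos fun i _ => hup i)] at hb
      exact hb
  have hmem : ∀ y ∈ (S₁ ∪ S₂)ᶜ,
      ∑ i, (Real.log (t i (y i)) - Real.log (q (y i))) ≤ (∑ i, relEnt (t i) q) + a ∧
      ∑ i, (Real.log (t i (y i)) - Real.log (w i (y i))) ≤ (∑ i, relEnt (t i) (w i)) + a := by
    intro y hy
    simpa [hS₁, hS₂] using hy
  obtain ⟨U, hU0, hU1, hUQ, hUF⟩ := exists_subdistribution
    (P := fun y : Fin n → Y => ∏ i, w i (y i)) (Q := fun y => ∏ i, q (y i))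
    (d := ∑ i, relEnt (t i) q) (e := ∑ i, relEnt (t i) (w i)) (R := R)
    (fun y => Finset.prod_nonneg fun i _ => (hq0 _).le) hT ha0.le _ hmass
    (fun y hy => hle (fun _ => q) _ y (fun i => (hq0 _).le) (fun i _ => hq0 _) (hmem y hy).1)
    (fun y hy => hle w _ y (fun i => (hw i).1 _) (fun i => htw i _) (hmem y hy).2)
  refine ⟨U, hU0, hU1, hUQ, ?_⟩
  have h6 : -4 * √(A * n) = -(2 * a) := by rw [ha]; ring
  rw [h6]
  exact hUF

/-- Choosing the tilting parameter optimally turns the divergences into `expo`. -/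
lemma exists_tilt_parameter {ι : Type*} [Fintype ι] {w : ι → Y → ℝ} {q : Y → ℝ} (R : ℝ)
    (hw : ∀ i, w i ∈ stdSimplex ℝ Y) (hq : ∀ y, 0 < q y) :
    ∃ s ∈ Set.Icc (0 : ℝ) 1, ∑ i, relEnt (tilted (1 + s)⁻¹ (w i) q) (w i) +
      max 0 (∑ i, relEnt (tilted (1 + s)⁻¹ (w i) q) q - R) = ∑ i, expo s (w i) q - s * R := by
  have hkey : ∀ s : ℝ, 0 ≤ s → ∑ i, expo s (w i) q =
      ∑ i, relEnt (tilted (1 + s)⁻¹ (w i) q) (w i) +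
        s * ∑ i, relEnt (tilted (1 + s)⁻¹ (w i) q) q := by
    intro s hs
    rw [Finset.mul_sum, ← Finset.sum_add_distrib]
    exact Finset.sum_congr rfl fun i _ => expo_eq hs (hw i) hq
  set h : ℝ → ℝ := fun s => ∑ i, relEnt (tilted (1 + s)⁻¹ (w i) q) q with hh
  have hcont : ContinuousOn h (Set.Icc 0 1) :=
    continuousOn_finsetSum _ fun i _ => continuousOn_relEnt_tilted (hw i) hq
  -- h is the s-derivative of Σ expo. If it does not exceed R at 0, or is at least R at 1, that
  -- endpoint works; otherwise the intermediate value theorem gives h s = R. Monotonicity of h is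
  -- not needed.
  rcases le_total (h 0) R with h0 | h0
  · refine ⟨0, ⟨le_rfl, zero_le_one⟩, ?_⟩
    have h1 := hkey 0 le_rfl
    change _ + max 0 (h 0 - R) = _
    rw [max_eq_left (by linarith)]
    linarith
  rcases le_total R (h 1) with h1 | h1
  · refine ⟨1, ⟨zero_le_one, le_rfl⟩, ?_⟩
    have h2 := hkey 1 zero_le_one
    change _ + max 0 (h 1 - R) = _
    change _ = _ + 1 * h 1 at h2
    rw [max_eq_right (by linarith)]
    linarith
  · obtain ⟨s, hs, hsR⟩ := intermediate_value_Icc' zero_le_one hcont ⟨h1, h0⟩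
    refine ⟨s, hs, ?_⟩
    have h2 := hkey s hs.1
    change _ + max 0 (h s - R) = _
    change _ = _ + s * h s at h2
    rw [hsR, sub_self, max_self]
    rw [hsR] at h2
    linarith

end

/-! ### The minimax saddle point and comparison with `optExp`. -/

section

variable {X Y : Type*} [Fintype Y]

/-- The distributions on `Y` all of whose probabilities are at least `κ`. -/
def floorSimplex (Y : Type*) [Fintype Y] (κ : ℝ) : Set (Y → ℝ) :=
  {q | q ∈ stdSimplex ℝ Y ∧ ∀ y, κ ≤ q y}

lemma convex_floorSimplex (κ : ℝ) : Convex ℝ (floorSimplex Y κ) := by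
  intro q hq q' hq' a b ha hb hab
  exact ⟨convex_stdSimplex ℝ Y hq.1 hq'.1 ha hb hab,
    fun y => (convex_Ici κ) (hq.2 y) (hq'.2 y) ha hb hab⟩

lemma isCompact_floorSimplex (κ : ℝ) : IsCompact (floorSimplex Y κ) := by
  have h : floorSimplex Y κ = stdSimplex ℝ Y ∩ {q | ∀ y, κ ≤ q y} := rfl
  rw [h]
  refine (isCompact_stdSimplex ℝ Y).inter_right ?_
  simp only [Set.ofPred_forall]
  exact isClosed_iInter fun y => isClosed_le continuous_const (continuous_apply y)

/-- Mixing with the uniform distribution lands in `floorSimplex` and loses a bounded factor. -/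
lemma exists_floorSimplex {η : ℝ} (hη : 0 < η) {q : Y → ℝ} (hq : q ∈ stdSimplex ℝ Y) :
    ∃ q' ∈ floorSimplex Y (η / (1 + η * Fintype.card Y)),
      ∀ y, q y ≤ (1 + η * Fintype.card Y) * q' y := by
  have hc : 0 < 1 + η * Fintype.card Y := by positivity
  refine ⟨fun y => (q y + η) / (1 + η * Fintype.card Y), ⟨⟨fun y => ?_, ?_⟩, fun y => ?_⟩,
    fun y => ?_⟩
  · exact div_nonneg (add_nonneg (hq.1 y) hη.le) hc.le
  · rw [← Finset.sum_div, Finset.sum_add_distrib, hq.2, Finset.sum_const, Finset.card_univ,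
      nsmul_eq_mul, mul_comm (Fintype.card Y : ℝ) η, div_self hc.ne']
  · exact div_le_div_of_nonneg_right (by linarith [hq.1 y]) hc.le
  · rw [mul_div_cancel₀ _ hc.ne']
    linarith

variable [Fintype X]

/-- A saddle point for the exponent function, in the output distribution and the parameter `s`. -/
lemma exists_saddle {W : X → Y → ℝ} (hW : IsChannel W) {κ : ℝ} (hκ : 0 < κ)
    (hne : (floorSimplex Y κ).Nonempty) {p : X → ℝ} (hp : p ∈ stdSimplex ℝ X) (r : ℝ) :
    ∃ q ∈ floorSimplex Y κ, ∃ s₀ ∈ Set.Icc (0 : ℝ) 1, ∀ s ∈ Set.Icc (0 : ℝ) 1,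
      ∀ q' ∈ floorSimplex Y κ,
        ∑ x, p x * expo s (W x) q - s * r ≤ ∑ x, p x * expo s₀ (W x) q' - s₀ * r := by
  have hpos : ∀ q ∈ floorSimplex Y κ, ∀ y, 0 < q y := fun q hq y => hκ.trans_le (hq.2 y)
  have hsub : floorSimplex Y κ ⊆ {q | ∀ y, 0 < q y} := hpos
  obtain ⟨q, hq, s₀, hs₀, h⟩ := Sion.exists_isSaddlePointOn
    (X := floorSimplex Y κ) (Y := Set.Icc (0 : ℝ) 1)
    (f := fun q s => ∑ x, p x * expo s (W x) q - s * r) hne (convex_floorSimplex κ)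
    (isCompact_floorSimplex κ)
    (fun s _ => ContinuousOn.lowerSemicontinuousOn <| ContinuousOn.sub
      (continuousOn_finsetSum _ fun x _ =>
        continuousOn_const.mul ((continuousOn_expo_right (hW x)).mono hsub)) continuousOn_const)
    (fun s hs => by
      refine ConvexOn.quasiconvexOn ⟨convex_floorSimplex κ, fun q hq q' hq' a b ha hb hab => ?_⟩
      have h1 : ∀ x, p x * expo s (W x) (a • q + b • q') ≤
          a * (p x * expo s (W x) q) + b * (p x * expo s (W x) q') := by
        intro x
        have := mul_le_mul_of_nonneg_left
          ((convexOn_expo hs.1 (hW x)).2 (hpos q hq) (hpos q' hq') ha hb hab) (hp.1 x)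
        simp only [smul_eq_mul] at this
        linarith
      have h2 := Finset.sum_le_sum (s := Finset.univ) fun x _ => h1 x
      rw [Finset.sum_add_distrib, ← Finset.mul_sum, ← Finset.mul_sum] at h2
      simp only [smul_eq_mul]
      have h3 : b = 1 - a := by linarith
      subst h3
      linarith)
    (convex_Icc 0 1) ⟨0, le_rfl, zero_le_one⟩ isCompact_Icc
    (fun q hq => ContinuousOn.upperSemicontinuousOn <| ContinuousOn.sub
      (continuousOn_finsetSum _ fun x _ =>
        continuousOn_const.mul (continuousOn_expo_left (hW x) (hpos q hq)))
      (continuousOn_id.mul continuousOn_const))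
    (fun q hq => by
      refine ConcaveOn.quasiconcaveOn ⟨convex_Icc 0 1, fun s hs s' hs' a b ha hb hab => ?_⟩
      have h1 : ∀ x, a * (p x * expo s (W x) q) + b * (p x * expo s' (W x) q) ≤
          p x * expo (a • s + b • s') (W x) q := by
        intro x
        have := mul_le_mul_of_nonneg_left
          ((concaveOn_expo (hW x) (hpos q hq)).2 hs hs' ha hb hab) (hp.1 x)
        simp only [smul_eq_mul] at this ⊢
        linarith
      have h2 := Finset.sum_le_sum (s := Finset.univ) fun x _ => h1 x
      rw [Finset.sum_add_distrib, ← Finset.mul_sum, ← Finset.mul_sum] at h2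
      simp only [smul_eq_mul] at h2 ⊢
      linarith)
  exact ⟨q, hq, s₀, hs₀, fun s hs q' hq' => h q' hq' s hs⟩

lemma tiltSum_le {α c : ℝ} (hα : α ≤ 1) (hc : 0 ≤ c) {w q q' : Y → ℝ} (hw : ∀ y, 0 ≤ w y)
    (hq : ∀ y, 0 ≤ q y) (hq' : ∀ y, 0 ≤ q' y) (hqq' : ∀ y, q y ≤ c * q' y) :
    tiltSum α w q ≤ c ^ (1 - α) * tiltSum α w q' := by
  rw [tiltSum, tiltSum, Finset.mul_sum]
  refine Finset.sum_le_sum fun y _ => ?_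
  have h1 : q y ^ (1 - α) ≤ (c * q' y) ^ (1 - α) :=
    Real.rpow_le_rpow (hq y) (hqq' y) (sub_nonneg.2 hα)
  rw [Real.mul_rpow hc (hq' y)] at h1
  have := mul_le_mul_of_nonneg_left h1 (Real.rpow_nonneg (hw y) α)
  linarith

/-- A real lower bound on the Rényi divergence of order below one. -/
lemma le_renyiDiv {α c : ℝ} (hα : α < 1) (hc : 0 < c) {w q q' : Y → ℝ}
    (hw : w ∈ stdSimplex ℝ Y) (hq : ∀ y, 0 ≤ q y) (hq' : ∀ y, 0 < q' y)
    (hqq' : ∀ y, q y ≤ c * q' y) :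
    ((1 / (α - 1) * ((1 - α) * Real.log c + Real.log (tiltSum α w q')) : ℝ) : EReal) ≤
      renyiDiv α w q := by
  have hneg : 1 / (α - 1) < 0 := one_div_neg.2 (by linarith)
  rw [renyiDiv, if_neg hα.ne, if_pos (Or.inl hα), ENNReal.log_ofReal]
  change _ ≤ _ * if tiltSum α w q ≤ 0 then ⊥ else ((Real.log (tiltSum α w q) : ℝ) : EReal)
  -- A vanishing sum means disjoint supports; the negative prefactor then turns log 0 = ⊥ into ⊤.
  split_ifs with h
  · rw [EReal.coe_mul_bot_of_neg hneg]
    exact le_top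
  · push Not at h
    rw [← EReal.coe_mul, EReal.coe_le_coe_iff]
    refine mul_le_mul_of_nonpos_left ?_ hneg.le
    have h1 := Real.log_le_log h
      (tiltSum_le hα.le hc.le hw.1 hq (fun y => (hq' y).le) hqq')
    rwa [Real.log_mul (Real.rpow_pos_of_pos hc _).ne' (tiltSum_pos hw hq').ne',
      Real.log_rpow hc] at h1

lemma coe_sum_ereal {ι : Type*} (t : Finset ι) (f : ι → ℝ) :
    ((∑ i ∈ t, f i : ℝ) : EReal) = ∑ i ∈ t, (f i : EReal) := by
  classical
  induction t using Finset.induction_on with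
  | empty => simp
  | insert a t ha ih => rw [Finset.sum_insert ha, Finset.sum_insert ha, EReal.coe_add, ih]

/-- Each term of the optimization defining `optExp`, bounded through a comparable distribution. -/
lemma exp_renyi_le {W : X → Y → ℝ} (hW : IsChannel W) {s c : ℝ} (hs : s ∈ Set.Icc (0 : ℝ) 1)
    (hc : 1 ≤ c) {p : X → ℝ} (hp : p ∈ stdSimplex ℝ X) {q q' : Y → ℝ} (hq : ∀ y, 0 ≤ q y)
    (hq' : ∀ y, 0 < q' y) (hqq' : ∀ y, q y ≤ c * q' y) (n : ℕ) (r : ℝ) :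
    EReal.exp (-(((n * ((1 - (1 + s)⁻¹) / (1 + s)⁻¹) : ℝ) : EReal) *
      ((∑ x, (p x : EReal) * renyiDiv (1 + s)⁻¹ (W x) q) - (r : EReal)))) ≤
    ENNReal.ofReal (c ^ n * Real.exp (-(n * (∑ x, p x * expo s (W x) q' - s * r)))) := by
  have hs1 : 0 < 1 + s := by linarith [hs.1]
  have hsα : (1 - (1 + s)⁻¹) / (1 + s)⁻¹ = s := by field_simp; ring
  have hcn : (1 : ℝ) ≤ c ^ n := one_le_pow₀ hc
  rw [hsα]
  -- At s = 0, that is α = 1, the divergence may be ⊤, but the zero prefactor kills it and the term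
  -- equals 1.
  rcases hs.1.eq_or_lt with h0 | h0
  · subst h0
    simp only [mul_zero, EReal.coe_zero, zero_mul, neg_zero, EReal.exp_zero, sub_zero]
    rw [Finset.sum_eq_zero fun x _ => by rw [expo_zero (hW x), mul_zero]]
    simpa using ENNReal.one_le_ofReal.2 hcn
  set α := (1 + s)⁻¹ with hα
  have hα1 : α < 1 := inv_lt_one_of_one_lt₀ (by linarith)
  have hc0 : 0 < c := by linarith
  set d : X → ℝ := fun x => 1 / (α - 1) * ((1 - α) * Real.log c + Real.log (tiltSum α (W x) q'))
    with hd
  have h1 : ((∑ x, p x * d x : ℝ) : EReal) ≤ ∑ x, (p x : EReal) * renyiDiv α (W x) q := by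
    rw [coe_sum_ereal]
    refine Finset.sum_le_sum fun x _ => ?_
    rw [EReal.coe_mul]
    exact mul_le_mul_of_nonneg_left (le_renyiDiv hα1 hc0 (hW x) hq hq' hqq')
      (EReal.coe_nonneg.2 (hp.1 x))
  have h2 : ((n * s * (∑ x, p x * d x - r) : ℝ) : EReal) ≤
      ((n * s : ℝ) : EReal) * ((∑ x, (p x : EReal) * renyiDiv α (W x) q) - (r : EReal)) := by
    rw [EReal.coe_mul, EReal.coe_sub]
    exact mul_le_mul_of_nonneg_left (EReal.sub_le_sub h1 le_rfl)
      (EReal.coe_nonneg.2 (by positivity))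
  refine (EReal.exp_monotone (EReal.neg_le_neg_iff.2 h2)).trans ?_
  rw [← EReal.coe_neg, EReal.exp_coe]
  refine ENNReal.ofReal_le_ofReal ?_
  have h3 : ∀ x, s * d x = expo s (W x) q' - s * Real.log c := by
    intro x
    have h4 : α - 1 = -(s / (1 + s)) := by rw [hα]; field_simp; ring
    have h5 : 1 - α = s / (1 + s) := by linarith
    simp only [hd, expo, h5, h4, ← hα]
    field_simp
    ring
  have h6 : s * ∑ x, p x * d x = ∑ x, p x * expo s (W x) q' - s * Real.log c := by
    rw [Finset.mul_sum, Finset.sum_congr rfl fun x _ => show s * (p x * d x) =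
      p x * expo s (W x) q' - p x * (s * Real.log c) by rw [← mul_sub, ← h3]; ring,
      Finset.sum_sub_distrib, ← Finset.sum_mul, hp.2, one_mul]
  have h7 : c ^ n = Real.exp (n * Real.log c) := by
    rw [Real.exp_nat_mul, Real.exp_log hc0]
  rw [h7, ← Real.exp_add]
  refine Real.exp_le_exp.2 ?_
  -- The actual loss is c^(ns), and s ≤ 1.
  have h8 : s * Real.log c ≤ Real.log c := mul_le_of_le_one_left (Real.log_nonneg hc) hs.2
  have h9 := mul_le_mul_of_nonneg_left h8 (Nat.cast_nonneg (α := ℝ) n)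
  have h10 : (n : ℝ) * s * (∑ x, p x * d x - r) = n * (s * ∑ x, p x * d x - s * r) := by ring
  rw [h10, h6]
  linarith

/-- For every input distribution some output distribution bounds `optExp` uniformly in `s`. -/
lemma exists_optExp_le {W : X → Y → ℝ} (hW : IsChannel W) {η : ℝ} (hη : 0 < η) {p : X → ℝ}
    (hp : p ∈ stdSimplex ℝ X) (n : ℕ) (r : ℝ) :
    ∃ q ∈ floorSimplex Y (η / (1 + η * Fintype.card Y)), ∀ s ∈ Set.Icc (0 : ℝ) 1,
      optExp W n r ≤ ENNReal.ofReal ((1 + η * Fintype.card Y) ^ n *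
        Real.exp (-(n * (∑ x, p x * expo s (W x) q - s * r)))) := by
  have hκ : 0 < η / (1 + η * Fintype.card Y) := by positivity
  have hne : (floorSimplex Y (η / (1 + η * Fintype.card Y))).Nonempty := by
    obtain ⟨x, -⟩ := exists_pos_of_mem_stdSimplex hp
    obtain ⟨q', hq', -⟩ := exists_floorSimplex hη (hW x)
    exact ⟨q', hq'⟩
  obtain ⟨q, hq, s₀, hs₀, h⟩ := exists_saddle hW hκ hne hp r
  refine ⟨q, hq, fun s hs => ?_⟩
  have hs1 : 0 < 1 + s₀ := by linarith [hs₀.1]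
  have hα : (1 + s₀)⁻¹ ∈ Set.Icc (1 / 2 : ℝ) 1 := by
    refine ⟨?_, inv_le_one_of_one_le₀ (by linarith [hs₀.1])⟩
    rw [one_div]
    exact inv_anti₀ hs1 (by linarith [hs₀.2])
  refine (iInf₂_le (1 + s₀)⁻¹ hα).trans <|
    (iInf₂_le p hp).trans <| iSup₂_le fun q'' hq'' => ?_
  obtain ⟨q', hq', hqq'⟩ := exists_floorSimplex hη hq''
  refine (exp_renyi_le hW hs₀ (le_add_of_nonneg_right (by positivity)) hp hq''.1
    (fun y => hκ.trans_le (hq'.2 y)) hqq' n r).trans (ENNReal.ofReal_le_ofReal ?_)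
  refine mul_le_mul_of_nonneg_left (Real.exp_le_exp.2 (neg_le_neg ?_)) (by positivity)
  exact mul_le_mul_of_nonneg_left (h s hs q' hq') (Nat.cast_nonneg n)

end

/-! ### From subdistributions to a simulating channel. -/

section

variable {X Y : Type*} [Fintype Y]

lemma fidelity_mono {p u v : Y → ℝ} (huv : ∀ y, u y ≤ v y) : fidelity p u ≤ fidelity p v :=
  pow_le_pow_left₀
    (Finset.sum_nonneg fun _ _ => mul_nonneg (Real.sqrt_nonneg _) (Real.sqrt_nonneg _))
    (Finset.sum_le_sum fun y _ =>
      mul_le_mul_of_nonneg_left (Real.sqrt_le_sqrt (huv y)) (Real.sqrt_nonneg _)) 2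

lemma fidelity_mul_right {c : ℝ} (hc : 0 ≤ c) (p u : Y → ℝ) :
    fidelity p (fun y => c * u y) = c * fidelity p u := by
  have h : ∀ y, √(p y) * √(c * u y) = √c * (√(p y) * √(u y)) := by
    intro y
    rw [Real.sqrt_mul hc]
    ring
  rw [fidelity, Finset.sum_congr rfl fun y _ => h y, ← Finset.mul_sum, mul_pow, Real.sq_sqrt hc,
    fidelity]

/-- A subdistribution below `M q` can be completed to a distribution below `M q`. -/
lemma exists_completion {M : ℝ} (hM : 1 ≤ M) {q u : Y → ℝ} (hq : q ∈ stdSimplex ℝ Y)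
    (hu0 : ∀ y, 0 ≤ u y) (hu1 : ∑ y, u y ≤ 1) (huq : ∀ y, u y ≤ M * q y) :
    ∃ v ∈ stdSimplex ℝ Y, (∀ y, u y ≤ v y) ∧ ∀ y, v y ≤ M * q y := by
  set m := ∑ y, u y with hm
  have hmM : m ≤ M := hu1.trans hM
  set θ := (1 - m) / (M - m) with hθ
  have hθ0 : 0 ≤ θ := div_nonneg (by linarith) (by linarith)
  have hθ1 : θ ≤ 1 := div_le_one_of_le₀ (by linarith) (by linarith)
  have hle : ∀ y, u y ≤ u y + θ * (M * q y - u y) := fun y =>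
    le_add_of_nonneg_right (mul_nonneg hθ0 (sub_nonneg.2 (huq y)))
  refine ⟨fun y => u y + θ * (M * q y - u y), ⟨fun y => (hu0 y).trans (hle y), ?_⟩, hle,
    fun y => ?_⟩
  · rw [Finset.sum_add_distrib, ← Finset.mul_sum, Finset.sum_sub_distrib, ← Finset.mul_sum, hq.2,
      ← hm, mul_one]
    -- If m = M then both equal 1, θ is 0/0 = 0, and u is already a distribution.
    rcases hmM.eq_or_lt with h | h
    · rw [h, sub_self, mul_zero]
      linarith
    · rw [hθ, div_mul_cancel₀ _ (sub_pos.2 h).ne']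
      ring
  · have := mul_le_of_le_one_left (sub_nonneg.2 (huq y)) hθ1
    linarith

/-- Subdistributions below a common `M q` with fidelity at least `c` bound the simulation error. -/
lemma half_le_one_sub_nsError [Nonempty X] {W : X → Y → ℝ} {M c : ℝ} (hM : 1 ≤ M) (hc : c ≤ 1)
    {q : Y → ℝ} (hq : q ∈ stdSimplex ℝ Y)
    (h : ∀ x, ∃ u : Y → ℝ, (∀ y, 0 ≤ u y) ∧ ∑ y, u y ≤ 1 ∧ (∀ y, u y ≤ M * q y) ∧
      c ≤ fidelity (W x) u) :
    c / 2 ≤ 1 - nsError W M := by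
  have h' : ∀ x, ∃ v ∈ stdSimplex ℝ Y, (∀ y, v y ≤ M * q y) ∧ c ≤ fidelity (W x) v := by
    intro x
    obtain ⟨u, hu0, hu1, huq, huc⟩ := h x
    obtain ⟨v, hv, huv, hvq⟩ := exists_completion hM hq hu0 hu1 huq
    exact ⟨v, hv, hvq, huc.trans (fidelity_mono huv)⟩
  choose V hV hVq hVc using h'
  have h1 : nsError W M ≤ channelPurifiedDist W V := by
    refine csInf_le ⟨0, ?_⟩ ⟨V, q, hV, hq, hVq, rfl⟩
    rintro e ⟨V', q', -, -, -, rfl⟩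
    exact Real.iSup_nonneg fun x => Real.sqrt_nonneg _
  -- Uses 1 - F ≤ 1 - c ≤ (1 - c/2)².
  have h2 : channelPurifiedDist W V ≤ 1 - c / 2 := by
    refine ciSup_le fun x => Real.sqrt_le_iff.2 ⟨by linarith, ?_⟩
    nlinarith [hVc x, sq_nonneg c]
  linarith

lemma log_sq_le_log_sq {a b : ℝ} (ha : 0 < a) (hab : a ≤ b) (hb : b ≤ 1) :
    Real.log b ^ 2 ≤ Real.log a ^ 2 := by
  have h1 := Real.log_le_log ha hab
  have h2 := Real.log_nonpos (ha.le.trans hab) hb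
  nlinarith

lemma constA_eq (η : ℝ) (W : X → Y → ℝ) : constA η W = 2 * Real.log (Fintype.card Y) ^ 2 +
    max (Real.log (minProb W) ^ 2) (Real.log (η / (1 + η * Fintype.card Y)) ^ 2) + 4 := rfl

lemma le_one_sub_nsError_zero [Nonempty X] {W : X → Y → ℝ} (hW : IsChannel W) (r : ℝ) :
    1 / 2 ≤ 1 - nsError (tensorPower W 0) (Real.exp ((0 : ℕ) * r)) := by
  have hmem : (fun y : Fin 0 → Y => ∏ i, W (Classical.arbitrary X) (y i)) ∈
      stdSimplex ℝ (Fin 0 → Y) := prod_mem_stdSimplex fun _ => hW _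
  refine half_le_one_sub_nsError (by simp) le_rfl hmem fun x => ⟨_, hmem.1, hmem.2.le, ?_, ?_⟩
  · simp
  · simp [fidelity, tensorPower]

/-! ### Types and the universal output distribution. -/

variable [Fintype X]

lemma minProb_pos_and_le {W : X → Y → ℝ} {x : X} {y : Y} (h : 0 < W x y) :
    0 < minProb W ∧ minProb W ≤ W x y := by
  have hmem : W x y ∈ {w : ℝ | ∃ x y, W x y = w ∧ 0 < w} := ⟨x, y, rfl, h⟩
  have hfin : {w : ℝ | ∃ x y, W x y = w ∧ 0 < w}.Finite := by
    refine (Set.finite_range fun z : X × Y => W z.1 z.2).subset ?_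
    rintro w ⟨x, y, hw, -⟩
    exact ⟨(x, y), hw⟩
  refine ⟨?_, csInf_le hfin.bddBelow hmem⟩
  obtain ⟨x', y', -, hpos⟩ := Set.Nonempty.csInf_mem ⟨_, hmem⟩ hfin
  exact hpos

open Classical in
/-- The number of occurrences of each letter in a word. -/
def letterCount {n : ℕ} (x : Fin n → X) (a : X) : Fin (n + 1) :=
  ⟨(Finset.univ.filter fun i => x i = a).card, Nat.lt_succ_of_le <| by
    simpa using Finset.card_filter_le (Finset.univ : Finset (Fin n)) fun i => x i = a⟩

lemma sum_letterCount_mul {n : ℕ} (x : Fin n → X) (f : X → ℝ) :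
    ∑ a, ((letterCount x a : ℕ) : ℝ) * f a = ∑ i, f (x i) := by
  classical
  rw [← Finset.sum_fiberwise Finset.univ x fun i => f (x i)]
  refine Finset.sum_congr rfl fun a _ => ?_
  rw [Finset.sum_congr rfl fun i hi => by rw [(Finset.mem_filter.1 hi).2], Finset.sum_const,
    nsmul_eq_mul]
  simp [letterCount]

/-- The empirical distribution attached to letter counts. -/
def empirical {n : ℕ} (c : X → Fin (n + 1)) (a : X) : ℝ := ((c a : ℕ) : ℝ) / n

lemma sum_empirical_mul {n : ℕ} (x : Fin n → X) (f : X → ℝ) :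
    ∑ a, empirical (letterCount x) a * f a = (∑ i, f (x i)) / n := by
  rw [← sum_letterCount_mul, Finset.sum_div]
  exact Finset.sum_congr rfl fun a _ => by rw [empirical]; ring

lemma empirical_mem_stdSimplex {n : ℕ} (hn : n ≠ 0) (x : Fin n → X) :
    empirical (letterCount x) ∈ stdSimplex ℝ X := by
  refine ⟨fun a => by unfold empirical; positivity, ?_⟩
  have := sum_empirical_mul x fun _ => 1
  simp only [mul_one, Finset.sum_const, Finset.card_univ, Fintype.card_fin, nsmul_eq_mul] at this
  rw [this]
  exact div_self (by exact_mod_cast hn)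

lemma gammaN_pos (n : ℕ) : 0 < gammaN X n := by unfold gammaN; positivity

lemma gammaN_le_one (n : ℕ) : gammaN X n ≤ 1 :=
  inv_le_one_of_one_le₀ (one_le_pow₀ (by linarith [Nat.cast_nonneg (α := ℝ) n]))

/-- The uniform mixture over all letter counts of product distributions. -/
def typeMixture {n : ℕ} (q : (X → Fin (n + 1)) → Y → ℝ) (y : Fin n → Y) : ℝ :=
  haveI := Classical.decEq X
  gammaN X n * ∑ c, ∏ i, q c (y i)

/-- The mixture runs over all maps X → {0,…,n}, including those not summing to n, so there are
exactly (n+1)^|X| terms and γ_n normalizes it. -/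
lemma typeMixture_mem_stdSimplex {n : ℕ} {q : (X → Fin (n + 1)) → Y → ℝ}
    (hq : ∀ c, q c ∈ stdSimplex ℝ Y) : typeMixture q ∈ stdSimplex ℝ (Fin n → Y) := by
  have hprod : ∀ c, (fun y : Fin n → Y => ∏ i, q c (y i)) ∈ stdSimplex ℝ (Fin n → Y) :=
    fun c => prod_mem_stdSimplex fun _ => hq c
  refine ⟨fun y => mul_nonneg (gammaN_pos n).le (Finset.sum_nonneg fun c _ => (hprod c).1 y), ?_⟩
  simp only [typeMixture]
  rw [← Finset.mul_sum, Finset.sum_comm, Finset.sum_congr rfl fun c _ => (hprod c).2]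
  simp only [Finset.sum_const, Finset.card_univ, Fintype.card_fun, Fintype.card_fin, nsmul_eq_mul,
    mul_one, gammaN]
  push_cast
  exact inv_mul_cancel₀ (by positivity)

lemma gammaN_mul_prod_le_typeMixture {n : ℕ} {q : (X → Fin (n + 1)) → Y → ℝ}
    (hq : ∀ c, q c ∈ stdSimplex ℝ Y) (c : X → Fin (n + 1)) (y : Fin n → Y) :
    gammaN X n * ∏ i, q c (y i) ≤ typeMixture q y :=
  letI := Classical.decEq X
  mul_le_mul_of_nonneg_left (Finset.single_le_sum
    (f := fun c => ∏ i, q c (y i))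
    (fun c _ => Finset.prod_nonneg fun _ _ => (hq c).1 _) (Finset.mem_univ c)) (gammaN_pos n).le

/-- At s = 0 the exponent vanishes. This gives finiteness and keeps the target fidelity at most 1.
-/
lemma optExp_le_pow [Nonempty X] {W : X → Y → ℝ} (hW : IsChannel W) {η : ℝ} (hη : 0 < η) (n : ℕ)
    (r : ℝ) : optExp W n r ≤ ENNReal.ofReal ((1 + η * Fintype.card Y) ^ n) := by
  classical
  obtain ⟨q, -, h⟩ := exists_optExp_le hW hη
    (single_mem_stdSimplex ℝ (Classical.arbitrary X)) n r
  refine (h 0 ⟨le_rfl, zero_le_one⟩).trans_eq ?_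
  rw [Finset.sum_eq_zero fun x _ => by rw [expo_zero (hW x), mul_zero]]
  simp

/-- The simulation error at positive blocklength. -/
lemma le_one_sub_nsError [Nonempty X] {W : X → Y → ℝ} (hW : IsChannel W) {r η : ℝ} (hr : 0 ≤ r)
    (hη : 0 < η) {n : ℕ} (hn : n ≠ 0) :
    gammaN X n / 8 * Real.exp (-4 * √(constA η W * n)) * ((1 + η * Fintype.card Y) ^ n)⁻¹ *
      (optExp W n r).toReal ≤ 1 - nsError (tensorPower W n) (Real.exp (n * r)) := by
  set D := (1 + η * Fintype.card Y) ^ n with hD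
  have hD0 : 0 < D := by positivity
  set κ := η / (1 + η * Fintype.card Y) with hκ
  have hκ0 : 0 < κ := by positivity
  have hγ := gammaN_pos (X := X) n
  set o := (optExp W n r).toReal with ho
  have ho0 : 0 ≤ o := ENNReal.toReal_nonneg
  have hchoice : ∀ p : X → ℝ, ∃ q ∈ floorSimplex Y κ, p ∈ stdSimplex ℝ X →
      ∀ s ∈ Set.Icc (0 : ℝ) 1,
        o ≤ D * Real.exp (-(n * (∑ x, p x * expo s (W x) q - s * r))) := by
    intro p
    by_cases hp : p ∈ stdSimplex ℝ X
    · obtain ⟨q, hq, h⟩ := exists_optExp_le hW hη hp n r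
      exact ⟨q, hq, fun _ s hs => ENNReal.toReal_le_of_le_ofReal (by positivity) (h s hs)⟩
    · obtain ⟨q, hq, -⟩ := exists_floorSimplex hη (hW (Classical.arbitrary X))
      exact ⟨q, hq, fun h => absurd h hp⟩
  choose q hq hqo using hchoice
  have hqs : ∀ c : X → Fin (n + 1), q (empirical c) ∈ stdSimplex ℝ Y := fun c => (hq _).1
  have hoD : o ≤ D := ENNReal.toReal_le_of_le_ofReal hD0.le (optExp_le_pow hW hη n r)
  set E := Real.exp (-4 * √(constA η W * n)) with hE
  have hE1 : E ≤ 1 := Real.exp_le_one_iff.2 (by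
    linarith [Real.sqrt_nonneg (constA η W * n)])
  have hE0 : 0 < E := Real.exp_pos _
  have hmain := half_le_one_sub_nsError (W := tensorPower W n) (M := Real.exp (n * r))
    (c := gammaN X n * (1 / 4 * E * (D⁻¹ * o)))
    (Real.one_le_exp (by positivity)) ?_ (typeMixture_mem_stdSimplex hqs) fun x => ?_
  · refine le_trans (le_of_eq ?_) hmain
    ring
  · have h1 : D⁻¹ * o ≤ 1 := by rw [inv_mul_le_iff₀ hD0, mul_one]; exact hoD
    have h2 : 1 / 4 * E * (D⁻¹ * o) ≤ 1 :=
      mul_le_one₀ (by linarith) (by positivity) h1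
    exact mul_le_one₀ (gammaN_le_one n) (by positivity) h2
  · set c := letterCount x with hc
    set u := q (empirical c) with hu
    have hu0 : ∀ y, 0 < u y := fun y => hκ0.trans_le ((hq _).2 y)
    obtain ⟨s, hs, hsR⟩ := exists_tilt_parameter (n * r) (fun i => hW (x i)) hu0
    obtain ⟨U, hU0, hU1, hUQ, hUF⟩ := exists_subdistribution_pi hn
      (B := max (Real.log (minProb W) ^ 2) (Real.log κ ^ 2)) (R := n * r)
      (inv_pos.2 (by linarith [hs.1] : 0 < 1 + s)) (fun i => hW (x i)) (hq _).1 hu0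
      (fun i y h => by
        obtain ⟨h1, h2⟩ := minProb_pos_and_le h
        exact (log_sq_le_log_sq h1 h2 (le_one_of_mem_stdSimplex (hW _) y)).trans
          (le_max_left _ _))
      (fun y => (log_sq_le_log_sq hκ0 ((hq _).2 y)
        (le_one_of_mem_stdSimplex (hq _).1 y)).trans (le_max_right _ _))
    -- Scaling by γ_n puts U below e^(nr) times the mixture and costs one factor γ_n in fidelity.
    refine ⟨fun y => gammaN X n * U y, fun y => mul_nonneg hγ.le (hU0 y), ?_, fun y => ?_, ?_⟩
    · rw [← Finset.mul_sum]
      exact mul_le_one₀ (gammaN_le_one n) (Finset.sum_nonneg fun y _ => hU0 y) hU1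
    · calc gammaN X n * U y ≤ gammaN X n * (Real.exp (n * r) * ∏ i, u (y i)) :=
            mul_le_mul_of_nonneg_left (hUQ y) hγ.le
        _ = Real.exp (n * r) * (gammaN X n * ∏ i, u (y i)) := by ring
        _ ≤ _ := mul_le_mul_of_nonneg_left (gammaN_mul_prod_le_typeMixture hqs c y)
            (Real.exp_pos _).le
    · rw [fidelity_mul_right hγ.le]
      refine mul_le_mul_of_nonneg_left (le_trans ?_ hUF) hγ.le
      change _ ≤ 1 / 4 * E * _
      refine mul_le_mul_of_nonneg_left ?_ (by positivity)
      rw [inv_mul_le_iff₀ hD0, hsR]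
      have h1 := hqo (empirical c) (empirical_mem_stdSimplex hn x) s hs
      rw [← hu, hc, sum_empirical_mul x fun a => expo s (W a) u] at h1
      refine h1.trans_eq ?_
      have hn0 : (n : ℝ) ≠ 0 := by exact_mod_cast hn
      congr 2
      field_simp

/-- The finite-blocklength bound. -/
lemma optExp_mul_le [Nonempty X] {W : X → Y → ℝ} (hW : IsChannel W) {r η : ℝ} (hr : 0 ≤ r)
    (hη : 0 < η) (n : ℕ) :
    ENNReal.ofReal (gammaN X n ^ 2 / 8 * Real.exp (-4 * √(constA η W * n)) *
        ((1 + η * Fintype.card Y) ^ n)⁻¹) * optExp W n r ≤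
      ENNReal.ofReal (1 - nsError (tensorPower W n) (Real.exp (n * r))) := by
  have hfin : optExp W n r ≠ ∞ :=
    ne_top_of_le_ne_top ENNReal.ofReal_ne_top (optExp_le_pow hW hη n r)
  rw [← ENNReal.ofReal_toReal hfin, ← ENNReal.ofReal_mul (by positivity)]
  refine ENNReal.ofReal_le_ofReal ?_
  have ho0 : 0 ≤ (optExp W n r).toReal := ENNReal.toReal_nonneg
  -- Empirical distributions need n ≠ 0; the empty word is simulated exactly.
  rcases eq_or_ne n 0 with rfl | hn
  · have h1 := le_one_sub_nsError_zero hW r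
    have h2 : (optExp W 0 r).toReal ≤ 1 :=
      ENNReal.toReal_le_of_le_ofReal zero_le_one (by simpa using optExp_le_pow hW hη 0 r)
    refine le_trans ?_ h1
    simp [gammaN]
    linarith
  · refine le_trans ?_ (le_one_sub_nsError hW hr hη hn)
    have h1 : gammaN X n ^ 2 ≤ gammaN X n := by
      rw [sq]
      exact mul_le_of_le_one_left (gammaN_pos n).le (gammaN_le_one n)
    gcongr

/-- The prefactor at `η = 1/n` is `exp (-O(√n log n))`. -/
lemma exists_exp_le_prefactor [Nonempty Y] (W : X → Y → ℝ) : ∃ C : ℝ, 0 < C ∧ ∀ n : ℕ, 2 ≤ n →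
    Real.exp (-(C * (√n * Real.log n))) ≤
      gammaN X n ^ 2 / 8 * Real.exp (-4 * √(constA (1 / (n : ℝ)) W * n)) *
        ((1 + 1 / (n : ℝ) * Fintype.card Y) ^ n)⁻¹ := by
  obtain ⟨k, hk⟩ : ∃ k : ℝ, k = Fintype.card Y := ⟨_, rfl⟩
  have hk1 : 1 ≤ k := by
    rw [hk]
    exact_mod_cast Fintype.card_pos
  obtain ⟨w, hw⟩ : ∃ w : ℝ, w = |Real.log (minProb W)| := ⟨_, rfl⟩
  have hw0 : 0 ≤ w := hw ▸ abs_nonneg _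
  have hlk : 0 ≤ Real.log k := Real.log_nonneg hk1
  have hlk1 : 0 ≤ Real.log (1 + k) := Real.log_nonneg (by linarith)
  -- Chosen so that √A ≤ d·log n: constants are absorbed using log n ≥ 1/2, and log(n+k) ≤ log n +
  -- log(1+k).
  set d := 4 * Real.log k + 2 * w + (1 + 2 * Real.log (1 + k)) + 4 with hd
  have hd0 : 0 ≤ d := by positivity
  -- The summands pay for 1/8 ≥ e^(-3), for γ_n² via n+1 ≤ n², for (1+k/n)^n ≤ e^k, and for the
  -- Chebyshev term.
  refine ⟨6 + 4 * Fintype.card X + 2 * k + 4 * d, by positivity, fun n hn => ?_⟩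
  have hn2 : (2 : ℝ) ≤ n := by exact_mod_cast hn
  have hn0 : (0 : ℝ) < n := by linarith
  set L := Real.log n with hL
  have hL2 : 1 / 2 ≤ L := by
    have := Real.log_two_gt_d9
    have := Real.log_le_log two_pos hn2
    linarith
  have hs1 : 1 ≤ √(n : ℝ) := Real.one_le_sqrt.2 (by linarith)
  set z := √(n : ℝ) * L with hz
  have hLz : L ≤ z := le_mul_of_one_le_left (by linarith) hs1
  have hγ : Real.exp (-(2 * Fintype.card X * L)) ≤ gammaN X n := by
    rw [Real.exp_neg, gammaN]
    refine inv_anti₀ (by positivity) ?_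
    have h1 : (2 : ℝ) * Fintype.card X * L = Fintype.card X * (2 * L) := by ring
    rw [h1, Real.exp_nat_mul]
    refine pow_le_pow_left₀ (by positivity) ?_ _
    have h2 : Real.exp (2 * L) = (n : ℝ) ^ 2 := by
      rw [two_mul, Real.exp_add, hL, Real.exp_log hn0, sq]
    rw [h2]
    nlinarith
  have hγ2 : Real.exp (-(4 * Fintype.card X * L)) ≤ gammaN X n ^ 2 := by
    have h1 := pow_le_pow_left₀ (Real.exp_pos _).le hγ 2
    rw [← Real.exp_nat_mul] at h1
    refine le_trans (le_of_eq ?_) h1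
    congr 1
    push_cast
    ring
  have h8 : Real.exp (-3) ≤ 1 / 8 := by
    rw [Real.exp_neg, one_div]
    refine inv_anti₀ (by norm_num) ?_
    have h1 : Real.exp 3 = Real.exp 1 ^ 3 := by rw [← Real.exp_nat_mul]; norm_num
    have h2 : (2 : ℝ) ≤ Real.exp 1 := by linarith [Real.exp_one_gt_d9]
    have h3 := pow_le_pow_left₀ zero_le_two h2 3
    rw [h1]
    linarith
  have hA : constA (1 / (n : ℝ)) W ≤ (d * L) ^ 2 := by
    have h1 : (1 / (n : ℝ)) / (1 + 1 / (n : ℝ) * k) = ((n : ℝ) + k)⁻¹ := by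
      field_simp
    have h2 : Real.log ((n : ℝ) + k) ≤ L + Real.log (1 + k) := by
      rw [hL, ← Real.log_mul hn0.ne' (by positivity)]
      exact Real.log_le_log (by positivity) (by nlinarith)
    have h3 : 0 ≤ Real.log ((n : ℝ) + k) := Real.log_nonneg (by linarith)
    rw [constA_eq, ← hk, h1, Real.log_inv, neg_sq, ← sq_abs (Real.log (minProb W)), ← hw]
    have h4 : max (w ^ 2) (Real.log ((n : ℝ) + k) ^ 2) ≤
        w ^ 2 + Real.log ((n : ℝ) + k) ^ 2 :=
      max_le (le_add_of_nonneg_right (sq_nonneg _)) (le_add_of_nonneg_left (sq_nonneg _))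
    set m := Real.log ((n : ℝ) + k) with hm
    have h5 : 2 * Real.log k ^ 2 + (w ^ 2 + m ^ 2) + 4 ≤ (2 * Real.log k + w + m + 2) ^ 2 := by
      nlinarith [mul_nonneg hlk hw0, mul_nonneg hlk h3, mul_nonneg hw0 h3, sq_nonneg (Real.log k)]
    have h6 : 2 * Real.log k + w + m + 2 ≤ d * L := by
      have a1 := mul_le_mul_of_nonneg_left hL2 hlk
      have a2 := mul_le_mul_of_nonneg_left hL2 hw0
      have a3 := mul_le_mul_of_nonneg_left hL2 hlk1
      rw [hd]
      linarith
    have h7 := pow_le_pow_left₀ (by positivity) h6 2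
    linarith
  have hS : Real.exp (-(4 * d * z)) ≤ Real.exp (-4 * √(constA (1 / (n : ℝ)) W * n)) := by
    refine Real.exp_le_exp.2 ?_
    have h1 : √(constA (1 / (n : ℝ)) W * n) ≤ d * z := by
      calc √(constA (1 / (n : ℝ)) W * n) ≤ √((d * L) ^ 2 * n) :=
            Real.sqrt_le_sqrt (mul_le_mul_of_nonneg_right hA hn0.le)
        _ = d * z := by
            rw [Real.sqrt_mul (sq_nonneg _), Real.sqrt_sq (mul_nonneg hd0 (by linarith)), hz]
            ring
    linarith
  have hK : Real.exp (-k) ≤ ((1 + 1 / (n : ℝ) * Fintype.card Y) ^ n)⁻¹ := by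
    rw [← hk, Real.exp_neg]
    refine inv_anti₀ (by positivity) ?_
    have h1 : 1 + 1 / (n : ℝ) * k ≤ Real.exp (1 / (n : ℝ) * k) := by
      linarith [Real.add_one_le_exp (1 / (n : ℝ) * k)]
    refine (pow_le_pow_left₀ (by positivity) h1 n).trans_eq ?_
    rw [← Real.exp_nat_mul]
    congr 1
    field_simp
  calc Real.exp (-((6 + 4 * Fintype.card X + 2 * k + 4 * d) * z))
      ≤ Real.exp (-(4 * Fintype.card X * L) + -3 + -(4 * d * z) + -k) := by
        refine Real.exp_le_exp.2 ?_
        have h1 := mul_le_mul_of_nonneg_left hLz (Nat.cast_nonneg (α := ℝ) (Fintype.card X))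
        have h2 := mul_le_mul_of_nonneg_left (hL2.trans hLz) (by linarith : 0 ≤ k)
        linarith
    _ = Real.exp (-(4 * Fintype.card X * L)) * Real.exp (-3) * Real.exp (-(4 * d * z)) *
        Real.exp (-k) := by rw [Real.exp_add, Real.exp_add, Real.exp_add]
    _ ≤ gammaN X n ^ 2 * (1 / 8) * Real.exp (-4 * √(constA (1 / (n : ℝ)) W * n)) *
        ((1 + 1 / (n : ℝ) * Fintype.card Y) ^ n)⁻¹ := by gcongr
    _ = _ := by ring

end

end ChannelSim

end

theorem mainTheorem8 {X Y : Type*} [Fintype X] [Nonempty X] [Fintype Y]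
    (W : X → Y → ℝ) (hW : ChannelSim.IsChannel W) :
    (∀ (r : ℝ), 0 ≤ r → ∀ (η : ℝ), 0 < η → ∀ (n : ℕ),
      ENNReal.ofReal
          (ChannelSim.gammaN X n ^ 2 / 8 *
            Real.exp (-4 * √(ChannelSim.constA η W * n)) *
            ((1 + η * Fintype.card Y) ^ n)⁻¹) *
          ChannelSim.optExp W n r
        ≤ ENNReal.ofReal
            (1 - ChannelSim.nsError (ChannelSim.tensorPower W n) (Real.exp (n * r)))) ∧
    (∃ C : ℝ, 0 < C ∧ ∀ (r : ℝ), 0 ≤ r → ∀ (n : ℕ), 2 ≤ n →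
      ENNReal.ofReal (Real.exp (-(C * (√n * Real.log n)))) * ChannelSim.optExp W n r
        ≤ ENNReal.ofReal
            (1 - ChannelSim.nsError (ChannelSim.tensorPower W n) (Real.exp (n * r)))) := by
  refine ⟨fun r hr η hη n => ChannelSim.optExp_mul_le hW hr hη n, ?_⟩
  have : Nonempty Y :=
    ⟨(ChannelSim.exists_pos_of_mem_stdSimplex (hW (Classical.arbitrary X))).choose⟩
  obtain ⟨C, hC, h⟩ := ChannelSim.exists_exp_le_prefactor W
  refine ⟨C, hC, fun r hr n hn => ?_⟩
  have hn0 : (0 : ℝ) < n := by exact_mod_cast (by lia : 0 < n)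
  refine le_trans ?_ (ChannelSim.optExp_mul_le hW hr (one_div_pos.2 hn0) n)
  gcongr
  exact h n hn
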